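/- Let $n\in\mathbb{C}$ with $\operatorname{Re}(n)>2$ and let $\alpha,\beta>0$ be real numbers such that $\alpha\beta=4\pi^2$. Let $\zeta$ denote the Riemann zeta function. Then the two series below converge absolutely, the principal value integral exists, and $$\sum_{j=1}^{\infty}\frac{(j-\tfrac12)^{n-1}}{e^{\beta(j-\frac12)}+1}+\frac{\Gamma(n)(2^{1-n}-1)\zeta(n)}{\beta^n} =\cos\left(\frac{\pi n}{2}\right)\left(\left(\frac{\alpha}{\beta}\right)^{n/2}\sum_{j=1}^{\infty}\frac{(j-\tfrac12)^{n-1}}{e^{\alpha(j-\frac12)}+1}+\frac{\Gamma(n)(2^{1-n}-1)\zeta(n)}{(2\pi)^n}\right)$$ $$-\sin\left(\frac{\pi n}{2}\right)\,\mathrm{P.V.}\!\int_0^\infty\frac{z^{n-1}}{e^{2\pi z}+1}\tan\left(\tfrac12\beta z\right)dz.$$ Here powers of positive reals are the principal ones, and $\mathrm{P.V.}\int_0^\infty$ denotes the limit, as $\varepsilon\to0^+$, of the absolutely convergent integral over the set of all $z>0$ whose distance from every pole $z=(2k+1)\pi/\beta$, $k=0,1,2,\dots$, of $\tan(\frac12\beta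 z)$ is at least $\varepsilon$. -/

import Mathlib

open Filter Topology MeasureTheory

/-- `HasCauchyPV f D S I` says that the Cauchy principal value of the integral of `f` over
`D ⊆ ℝ`, with respect to the set `S` of singular points, exists and equals `I`: for each
`ε > 0` the function `f` is (absolutely) integrable on the part of `D` outside of the symmetric
intervals `(s - ε, s + ε)`, `s ∈ S`, and these integrals tend to `I` as `ε → 0+`. -/
def HasCauchyPV (f : ℝ → ℂ) (D S : Set ℝ) (I : ℂ) : Prop :=
  (∀ ε : ℝ, 0 < ε → IntegrableOn f (D \ ⋃ s ∈ S, Set.Ioo (s - ε) (s + ε)) volume) ∧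
    Tendsto (fun ε : ℝ => ∫ z in D \ ⋃ s ∈ S, Set.Ioo (s - ε) (s + ε), f z)
      (𝓝[>] (0 : ℝ)) (𝓝 I)

/-- The series `∑_{j ≥ 1} (j - 1/2)^(n-1) / (e^{c (j - 1/2)} + 1)` has this general term; the
index is shifted so that `j = 0, 1, 2, …` and `j + 1/2` stands for `j - 1/2`. -/
noncomputable def halfIntTerm (n : ℂ) (c : ℝ) (j : ℕ) : ℂ :=
  (((j : ℝ) + 1 / 2 : ℝ) : ℂ) ^ (n - 1) / ((Real.exp (c * ((j : ℝ) + 1 / 2)) + 1 : ℝ) : ℂ)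

/-- The integrand `z^(n-1) tan(β z / 2) / (e^{2 π z} + 1)` on the positive real axis. -/
noncomputable def tanIntegrand (n : ℂ) (β : ℝ) (z : ℝ) : ℂ :=
  (z : ℂ) ^ (n - 1) / ((Real.exp (2 * Real.pi * z) + 1 : ℝ) : ℂ) *
    ((Real.tan (β * z / 2) : ℝ) : ℂ)

/-- The poles of `tan(β z / 2)` on the positive real axis. -/
def tanPoles (β : ℝ) : Set ℝ :=
  {z : ℝ | 0 < z ∧ Real.cos (β * z / 2) = 0}

/-! Everything reduces to the double series S(a,b) = ∑_{l,m≥1} (-1)^(l+m) (a l + i b m)^(-n), which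
is `fermiDoubleSum`; it converges absolutely because Re n > 2. Poisson summation at the
half-integers (`tsum_halfIntTerm`) turns each series of the theorem into its zeta term, with
opposite sign, minus Γ(n)(S(c,2π) + S(c,-2π)). Formally tan(θ/2) = 2 ∑_{l≥1} (-1)^(l-1) sin(lθ), and
integrating this termwise gives the principal value -iΓ(n)(S(2π,-β) - S(2π,β))
(`hasCauchyPV_tanIntegrand`). The termwise integration is justified by `exists_hasCauchyPV_tan`:
subtracting from the integrand's smooth factor its value at the pole leaves an integrable quotient,
to which Riemann-Lebesgue applies, and the subtracted part cancels by oddness about each pole.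
Scaling (`fermiDoubleSum_mul`) and the quarter turn S(a,-b) = e^(iπn/2) S(b,a)
(`fermiDoubleSum_swap_neg`) express all these values through X = S(β,2π) and Y = S(2π,β). The
theorem is then Euler's formula and cos² + sin² = 1. -/

/-- The function `x ^ (n - 1) / (e ^ (c x) + 1)`. -/
noncomputable def fermi (n : ℂ) (c : ℝ) (x : ℝ) : ℂ :=
  (x : ℂ) ^ (n - 1) / ((Real.exp (c * x) + 1 : ℝ) : ℂ)

/-! ### Laplace transform of a power, with complex parameter -/

theorem integrableOn_rpow_mul_exp_neg_mul {s b : ℝ} (hs : -1 < s) (hb : 0 < b) :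
    IntegrableOn (fun t : ℝ => t ^ s * Real.exp (-(b * t))) (Set.Ioi 0) := by
  simpa [neg_mul] using integrableOn_rpow_mul_exp_neg_mul_rpow hs one_pos hb

theorem norm_cpow_mul_exp_neg {s r : ℂ} {t : ℝ} (ht : 0 < t) :
    ‖(t : ℂ) ^ s * Complex.exp (-(r * t))‖ = t ^ s.re * Real.exp (-(r.re * t)) := by
  rw [norm_mul, Complex.norm_cpow_eq_rpow_re_of_pos ht, Complex.norm_exp]
  simp

theorem continuousOn_ofReal_cpow (s : ℂ) :
    ContinuousOn (fun t : ℝ => (t : ℂ) ^ s) (Set.Ioi 0) := fun t ht =>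
  ((Complex.continuous_ofReal.continuousAt (x := t)).cpow continuousAt_const
    (Complex.ofReal_mem_slitPlane.2 ht)).continuousWithinAt

theorem aestronglyMeasurable_cpow_mul_exp (s r : ℂ) :
    AEStronglyMeasurable (fun t : ℝ => (t : ℂ) ^ s * Complex.exp (-(r * t)))
      (volume.restrict (Set.Ioi 0)) :=
  ((continuousOn_ofReal_cpow s).mul (by fun_prop)).aestronglyMeasurable measurableSet_Ioi

theorem integrableOn_cpow_mul_exp_neg_mul {s r : ℂ} (hs : -1 < s.re) (hr : 0 < r.re) :
    IntegrableOn (fun t : ℝ => (t : ℂ) ^ s * Complex.exp (-(r * t))) (Set.Ioi 0) := by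
  refine (integrableOn_rpow_mul_exp_neg_mul hs hr).mono'
    (aestronglyMeasurable_cpow_mul_exp s r) ?_
  filter_upwards [ae_restrict_mem measurableSet_Ioi] with t ht
  exact (norm_cpow_mul_exp_neg ht).le

theorem hasDerivAt_integral_cpow_mul_exp {a r : ℂ} (ha : 0 < a.re) (hr : 0 < r.re) :
    HasDerivAt (fun r : ℂ => ∫ t in Set.Ioi (0 : ℝ), (t : ℂ) ^ (a - 1) * Complex.exp (-(r * t)))
      (∫ t in Set.Ioi (0 : ℝ), (t : ℂ) ^ (a - 1) * Complex.exp (-(r * t)) * (-t)) r := by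
  refine (hasDerivAt_integral_of_dominated_loc_of_deriv_le
    (μ := volume.restrict (Set.Ioi (0 : ℝ)))
    (F := fun r (t : ℝ) => (t : ℂ) ^ (a - 1) * Complex.exp (-(r * t)))
    (F' := fun r (t : ℝ) => (t : ℂ) ^ (a - 1) * Complex.exp (-(r * t)) * (-t))
    -- On this ball the real part stays at least `r.re / 2`, which gives the uniform majorant.
    (s := Metric.ball r (r.re / 2))
    (bound := fun t => t ^ a.re * Real.exp (-(r.re / 2 * t)))
    (Metric.ball_mem_nhds r (by linarith)) ?_ ?_ ?_ ?_ ?_ ?_).2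
  · exact Eventually.of_forall fun r => aestronglyMeasurable_cpow_mul_exp _ r
  · exact integrableOn_cpow_mul_exp_neg_mul (by simpa using ha) hr
  · exact (aestronglyMeasurable_cpow_mul_exp _ r).mul (by fun_prop)
  · filter_upwards [ae_restrict_mem measurableSet_Ioi] with t ht q hq
    have ht : 0 < t := ht
    rw [norm_mul, norm_cpow_mul_exp_neg ht, norm_neg, Complex.norm_of_nonneg ht.le]
    have h1 : r.re / 2 ≤ q.re := by
      have := (Complex.abs_re_le_norm (q - r)).trans_lt (mem_ball_iff_norm.1 hq)
      have := (abs_lt.1 this).1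
      simp only [Complex.sub_re] at this
      linarith
    have h2 : t ^ (a - 1).re * t = t ^ a.re := by
      conv_lhs => rw [← Real.rpow_one t, ← Real.rpow_mul ht.le, one_mul]
      rw [← Real.rpow_add ht]; simp
    calc _ = t ^ a.re * Real.exp (-(q.re * t)) := by rw [← h2]; ring
      _ ≤ _ := by gcongr
  · exact integrableOn_rpow_mul_exp_neg_mul (by linarith) (by linarith)
  · filter_upwards with t q _
    have : HasDerivAt (fun q : ℂ => -(q * (t : ℂ))) (-t) q := by
      have h := ((hasDerivAt_id q).mul_const (t : ℂ)).neg
      rw [one_mul] at h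
      exact h
    simpa [mul_assoc] using (this.cexp.const_mul ((t : ℂ) ^ (a - 1)))

/-- The Laplace transform of `t ^ (a - 1)`, in the whole right half-plane. -/
theorem integral_cpow_mul_exp_neg_mul_Ioi_of_re_pos {a r : ℂ} (ha : 0 < a.re) (hr : 0 < r.re) :
    ∫ t in Set.Ioi (0 : ℝ), (t : ℂ) ^ (a - 1) * Complex.exp (-(r * t)) =
      (1 / r) ^ a * Complex.Gamma a := by
  have hopen : IsOpen {r : ℂ | 0 < r.re} := isOpen_lt continuous_const Complex.continuous_re
  have h1 : AnalyticOnNhd ℂ (fun r : ℂ =>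
      ∫ t in Set.Ioi (0 : ℝ), (t : ℂ) ^ (a - 1) * Complex.exp (-(r * t))) {r : ℂ | 0 < r.re} :=
    DifferentiableOn.analyticOnNhd (fun r hr =>
      (hasDerivAt_integral_cpow_mul_exp ha hr).differentiableAt.differentiableWithinAt) hopen
  have h2 : AnalyticOnNhd ℂ (fun r : ℂ => (1 / r) ^ a * Complex.Gamma a) {r : ℂ | 0 < r.re} := by
    refine DifferentiableOn.analyticOnNhd (fun r hr => ?_) hopen
    have hr : 0 < r.re := hr
    have hr0 : r ≠ 0 := by rintro rfl; simp at hr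
    refine (DifferentiableAt.mul_const (DifferentiableAt.cpow ?_ ?_ ?_) _).differentiableWithinAt
    · exact (differentiableAt_const _).div differentiableAt_id hr0
    · exact differentiableAt_const _
    · rw [one_div]
      exact Or.inl (by rw [Complex.inv_re]; exact div_pos hr (Complex.normSq_pos.2 hr0))
  -- Identity theorem: both sides are analytic in the half-plane and agree at the real points 1 +
  -- 1/(k+1), which accumulate at 1.
  refine h1.eqOn_of_preconnected_of_frequently_eq h2
    (convex_halfSpace_re_gt 0).isPreconnected (z₀ := 1) (by simp) ?_ hr
  have key : ∀ k : ℕ, (fun r : ℂ => ∫ t in Set.Ioi (0 : ℝ),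
      (t : ℂ) ^ (a - 1) * Complex.exp (-(r * t))) ((1 + 1 / ((k : ℝ) + 1) : ℝ) : ℂ) =
      (1 / ((1 + 1 / ((k : ℝ) + 1) : ℝ) : ℂ)) ^ a * Complex.Gamma a := fun k =>
    Complex.integral_cpow_mul_exp_neg_mul_Ioi ha (by positivity)
  have ht : Tendsto (fun k : ℕ => ((1 + 1 / ((k : ℝ) + 1) : ℝ) : ℂ)) atTop (𝓝[≠] 1) := by
    refine tendsto_nhdsWithin_iff.2 ⟨?_, Eventually.of_forall fun k => ?_⟩
    · have := (tendsto_one_div_add_atTop_nhds_zero_nat (𝕜 := ℝ)).const_add 1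
      rw [add_zero] at this
      have h := (Complex.continuous_ofReal.tendsto (1 : ℝ)).comp this
      rwa [Complex.ofReal_one] at h
    · have : (0 : ℝ) < 1 / ((k : ℝ) + 1) := by positivity
      simp only [Set.mem_compl_iff, Set.mem_singleton_iff]
      intro h
      have h : (1 + 1 / ((k : ℝ) + 1) : ℝ) = 1 := by exact_mod_cast h
      linarith
  exact ht.frequently (Eventually.of_forall key).frequently

/-! ### Alternating expansions of the Fermi factor and of zeta -/

theorem hasSum_neg_one_pow_mul_exp {u : ℝ} (hu : 0 < u) :
    HasSum (fun l : ℕ => (-1 : ℂ) ^ l * Complex.exp (-(((l : ℝ) + 1 : ℝ) * u)))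
      (1 / ((Real.exp u + 1 : ℝ) : ℂ)) := by
  have h1 : ‖-Complex.exp (-(u : ℂ))‖ < 1 := by
    rw [norm_neg, Complex.norm_exp]; simpa using hu
  have h := (hasSum_geometric_of_norm_lt_one h1).mul_right (Complex.exp (-(u : ℂ)))
  have hv : (1 - -Complex.exp (-(u : ℂ)))⁻¹ * Complex.exp (-(u : ℂ)) =
      1 / ((Real.exp u + 1 : ℝ) : ℂ) := by
    have h3 : ((Real.exp u + 1 : ℝ) : ℂ) ≠ 0 := by
      exact_mod_cast (by positivity : Real.exp u + 1 ≠ 0)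
    have h4 : (1 - -Complex.exp (-(u : ℂ))) = ((Real.exp u + 1 : ℝ) : ℂ) * Complex.exp (-(u : ℂ)) := by
      push_cast
      rw [add_mul, ← Complex.exp_add]; simp
    rw [h4, mul_inv, mul_assoc, inv_mul_cancel₀ (Complex.exp_ne_zero _)]; simp
  rw [hv] at h
  refine h.congr_fun fun l => ?_
  rw [neg_pow (Complex.exp _), mul_assoc, ← Complex.exp_nat_mul, ← Complex.exp_add]
  congr 2
  push_cast
  ring

theorem hasSum_fermi (n : ℂ) {c x : ℝ} (hc : 0 < c) (hx : 0 < x) (y : ℝ) :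
    HasSum (fun l : ℕ => (-1 : ℂ) ^ l * ((x : ℂ) ^ (n - 1) *
      Complex.exp (-(((c * ((l : ℝ) + 1) : ℝ) + Complex.I * y) * x))))
      (fermi n c x * Complex.exp (-(Complex.I * y * x))) := by
  have h := (hasSum_neg_one_pow_mul_exp (mul_pos hc hx)).mul_left
    ((x : ℂ) ^ (n - 1) * Complex.exp (-(Complex.I * y * x)))
  have e : fermi n c x * Complex.exp (-(Complex.I * y * x)) =
      (x : ℂ) ^ (n - 1) * Complex.exp (-(Complex.I * y * x)) *
        (1 / ((Real.exp (c * x) + 1 : ℝ) : ℂ)) := by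
    rw [fermi]; ring
  rw [e]
  refine h.congr_fun fun l => ?_
  have : Complex.exp (-(((c * ((l : ℝ) + 1) : ℝ) + Complex.I * y) * x)) =
      Complex.exp (-(Complex.I * y * x)) * Complex.exp (-(((l : ℝ) + 1 : ℝ) * (c * x : ℝ))) := by
    rw [← Complex.exp_add]
    congr 1
    push_cast
    ring
  rw [this]
  ring

/-- Expand 1/(e^(cx)+1) geometrically and integrate termwise. The integrals of the norms do not see
y and are a constant times (l+1)^(-Re n), so the interchange is legitimate. -/
theorem hasSum_integral_fermi_mul_exp {n : ℂ} (hn : 1 < n.re) {c : ℝ} (hc : 0 < c) (y : ℝ) :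
    HasSum (fun l : ℕ => (-1 : ℂ) ^ l *
      ((1 / ((c * ((l : ℝ) + 1) : ℝ) + Complex.I * y)) ^ n * Complex.Gamma n))
      (∫ x in Set.Ioi (0 : ℝ), fermi n c x * Complex.exp (-(Complex.I * y * x))) := by
  have hre : ∀ l : ℕ, (((c * ((l : ℝ) + 1) : ℝ) : ℂ) + Complex.I * y).re = c * ((l : ℝ) + 1) := by
    intro l; simp
  have hpos : ∀ l : ℕ, 0 < c * ((l : ℝ) + 1) := fun l => by positivity
  have hn1 : -1 < (n - 1).re := by simp; linarith
  have hint := hasSum_integral_of_summable_integral_norm (μ := volume.restrict (Set.Ioi (0 : ℝ)))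
    (F := fun (l : ℕ) (x : ℝ) => (-1 : ℂ) ^ l * ((x : ℂ) ^ (n - 1) *
      Complex.exp (-(((c * ((l : ℝ) + 1) : ℝ) + Complex.I * y) * x)))) ?_ ?_
  · have e : ∫ x in Set.Ioi (0 : ℝ), fermi n c x * Complex.exp (-(Complex.I * y * x)) =
        ∫ x in Set.Ioi (0 : ℝ), ∑' l : ℕ, (-1 : ℂ) ^ l * ((x : ℂ) ^ (n - 1) *
          Complex.exp (-(((c * ((l : ℝ) + 1) : ℝ) + Complex.I * y) * x))) :=
      setIntegral_congr_fun measurableSet_Ioi fun x hx => (hasSum_fermi n hc hx y).tsum_eq.symm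
    rw [e]
    refine hint.congr_fun fun l => ?_
    rw [integral_const_mul, integral_cpow_mul_exp_neg_mul_Ioi_of_re_pos (by linarith)
      (by rw [hre]; exact hpos l)]
  · intro l
    exact (integrableOn_cpow_mul_exp_neg_mul hn1 (by rw [hre]; exact hpos l)).const_mul _
  · have e : ∀ l : ℕ, ∫ x in Set.Ioi (0 : ℝ), ‖(-1 : ℂ) ^ l * ((x : ℂ) ^ (n - 1) *
        Complex.exp (-(((c * ((l : ℝ) + 1) : ℝ) + Complex.I * y) * x)))‖ =
        (1 / c) ^ n.re * Real.Gamma n.re * (1 / ((l + 1 : ℕ) : ℝ) ^ n.re) := by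
      intro l
      have : ∀ x ∈ Set.Ioi (0 : ℝ), ‖(-1 : ℂ) ^ l * ((x : ℂ) ^ (n - 1) *
          Complex.exp (-(((c * ((l : ℝ) + 1) : ℝ) + Complex.I * y) * x)))‖ =
          x ^ (n.re - 1) * Real.exp (-(c * ((l : ℝ) + 1) * x)) := by
        intro x hx
        rw [norm_mul, norm_cpow_mul_exp_neg hx, hre]
        simp
      rw [setIntegral_congr_fun measurableSet_Ioi this,
        Real.integral_rpow_mul_exp_neg_mul_Ioi (by linarith) (hpos l)]
      rw [one_div (c * _), one_div c, Real.inv_rpow (hpos l).le,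
        Real.mul_rpow hc.le (by positivity), Real.inv_rpow hc.le, mul_inv]
      push_cast
      ring
    simp_rw [e]
    exact ((summable_nat_add_iff 1).2 (Real.summable_one_div_nat_rpow.2 hn)).mul_left _

theorem hasSum_neg_one_pow_mul_one_div_cpow {n : ℂ} (hn : 1 < n.re) :
    HasSum (fun l : ℕ => (-1 : ℂ) ^ l * (1 / (l + 1 : ℂ) ^ n))
      ((1 - 2 ^ (1 - n)) * riemannZeta n) := by
  have hs : Summable fun l : ℕ => 1 / ((l : ℂ) + 1) ^ n := by
    have := (summable_nat_add_iff 1).2 (Complex.summable_one_div_nat_cpow.2 hn)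
    simpa using this
  have hz : HasSum (fun l : ℕ => 1 / ((l : ℂ) + 1) ^ n) (riemannZeta n) := by
    rw [zeta_eq_tsum_one_div_nat_add_one_cpow hn]; exact hs.hasSum
  -- The index is shifted by one, so odd indices carry the even integers 2k + 2.
  have hodd : HasSum (fun k : ℕ => 1 / (((2 * k + 1 : ℕ) : ℂ) + 1) ^ n)
      (2 ^ (-n) * riemannZeta n) := by
    refine (hz.mul_left ((2 : ℂ) ^ (-n))).congr_fun fun k => ?_
    have : (((2 * k + 1 : ℕ) : ℂ) + 1) = ((2 : ℝ) : ℂ) * (((k : ℝ) + 1 : ℝ) : ℂ) := by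
      push_cast; ring
    rw [this, Complex.mul_cpow_ofReal_nonneg (by norm_num) (by positivity), Complex.cpow_neg]
    push_cast
    rw [one_div, one_div, mul_inv]
  have heven : HasSum (fun k : ℕ => 1 / (((2 * k : ℕ) : ℂ) + 1) ^ n)
      (riemannZeta n - 2 ^ (-n) * riemannZeta n) := by
    have h1 : Summable fun k : ℕ => 1 / (((2 * k : ℕ) : ℂ) + 1) ^ n :=
      hs.comp_injective (i := fun k : ℕ => 2 * k) (fun a b h => by simpa using h)
    have h2 := h1.hasSum.even_add_odd (f := fun l : ℕ => 1 / ((l : ℂ) + 1) ^ n) hodd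
    rw [← eq_sub_of_add_eq (h2.unique hz)]
    exact h1.hasSum
  have h := HasSum.even_add_odd (f := fun l : ℕ => (-1 : ℂ) ^ l * (1 / (l + 1 : ℂ) ^ n))
    (m := riemannZeta n - 2 ^ (-n) * riemannZeta n) (m' := -(2 ^ (-n) * riemannZeta n))
    (heven.congr_fun fun k => by simp) (hodd.neg.congr_fun fun k => by simp [pow_succ])
  convert h using 1
  rw [sub_eq_add_neg 1 n, Complex.cpow_add _ _ two_ne_zero, Complex.cpow_one]
  ring

/-! ### The alternating double series: convergence, scaling and quarter turn -/

/-- Since x|y| ≤ x² + y², the modulus splits into a product of powers of x and |y|, so the double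
series is dominated by a product of two single series of exponent Re n / 2 > 1. The exponential
factor absorbs the argument when n is not real. -/
theorem norm_one_div_cpow_le {n : ℂ} (hn : 0 < n.re) {x y : ℝ} (hx : 0 < x) (hy : y ≠ 0) :
    ‖(1 / ((x : ℂ) + Complex.I * y)) ^ n‖ ≤
      Real.exp (Real.pi * |n.im|) * ((1 / x ^ (n.re / 2)) * (1 / |y| ^ (n.re / 2))) := by
  set w : ℂ := (x : ℂ) + Complex.I * y with hw
  have hy' : 0 < |y| := abs_pos.2 hy
  have h1 : x * |y| ≤ ‖w‖ ^ 2 := by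
    rw [← Complex.normSq_eq_norm_sq, Complex.normSq_apply]
    simp only [hw, Complex.add_re, Complex.ofReal_re, Complex.mul_re, Complex.I_re, zero_mul,
      Complex.I_im, Complex.ofReal_im, Complex.add_im, Complex.mul_im]
    nlinarith [sq_nonneg (x - |y|), abs_mul_abs_self y]
  have h2 : ‖1 / w‖ ^ n.re ≤ (1 / x ^ (n.re / 2)) * (1 / |y| ^ (n.re / 2)) := by
    rw [one_div_mul_one_div, ← Real.mul_rpow hx.le hy'.le, norm_div, norm_one,
      Real.div_rpow zero_le_one (norm_nonneg _), Real.one_rpow]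
    have : ‖w‖ ^ n.re = (‖w‖ ^ 2) ^ (n.re / 2) := by
      rw [← Real.rpow_natCast, ← Real.rpow_mul (norm_nonneg _)]
      congr 1; push_cast; ring
    rw [this]
    exact one_div_le_one_div_of_le (by positivity)
      (Real.rpow_le_rpow (by positivity) h1 (by linarith))
  refine (Complex.norm_cpow_le _ _).trans ?_
  rw [div_eq_mul_inv, ← Real.exp_neg, mul_comm]
  refine mul_le_mul (Real.exp_le_exp.2 ?_) h2 (by positivity) (by positivity)
  calc _ ≤ |(1 / w).arg * n.im| := neg_le_abs _
    _ ≤ _ := by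
      rw [abs_mul]
      exact mul_le_mul_of_nonneg_right (Complex.abs_arg_le_pi _) (abs_nonneg _)

theorem mul_cpow_of_arg_add_mem {x y : ℂ} (hx : x ≠ 0) (hy : y ≠ 0)
    (h : x.arg + y.arg ∈ Set.Ioc (-Real.pi) Real.pi) (n : ℂ) : (x * y) ^ n = x ^ n * y ^ n := by
  rw [Complex.cpow_def_of_ne_zero (mul_ne_zero hx hy), Complex.cpow_def_of_ne_zero hx,
    Complex.cpow_def_of_ne_zero hy, Complex.log_mul hx hy h, add_mul, Complex.exp_add]

/-- In the closed right half-plane |arg y| ≤ π/2, so adding π/2 does not cross the branch cut. -/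
theorem I_mul_cpow_of_re_nonneg {y : ℂ} (hy : y ≠ 0) (h : 0 ≤ y.re) (n : ℂ) :
    (Complex.I * y) ^ n = Complex.exp (Complex.I * (Real.pi * n / 2)) * y ^ n := by
  have h1 := abs_le.1 (Complex.abs_arg_le_pi_div_two_iff.2 h)
  rw [mul_cpow_of_arg_add_mem Complex.I_ne_zero hy, Complex.cpow_def_of_ne_zero Complex.I_ne_zero,
    Complex.log_I]
  · congr 2; ring
  · rw [Complex.arg_I]
    exact ⟨by linarith [Real.pi_pos, h1.1], by linarith [h1.2]⟩

/-- The summand of the double series `fermiDoubleSum`. -/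
noncomputable def fermiDoubleTerm (n : ℂ) (a b : ℝ) (p : ℕ × ℕ) : ℂ :=
  (-1) ^ (p.1 + p.2) *
    (1 / ((a * ((p.1 : ℝ) + 1) : ℝ) + Complex.I * (b * ((p.2 : ℝ) + 1) : ℝ))) ^ n

/-- The alternating double series of the `(a l + i b m) ^ (-n)`, `l, m ≥ 1`. -/
noncomputable def fermiDoubleSum (n : ℂ) (a b : ℝ) : ℂ :=
  ∑' p : ℕ × ℕ, fermiDoubleTerm n a b p

theorem summable_fermiDoubleTerm {n : ℂ} (hn : 2 < n.re) {a b : ℝ} (ha : 0 < a) (hb : b ≠ 0) :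
    Summable (fermiDoubleTerm n a b) := by
  have hs : Summable fun l : ℕ => 1 / ((l + 1 : ℕ) : ℝ) ^ (n.re / 2) :=
    (summable_nat_add_iff 1).2 (Real.summable_one_div_nat_rpow.2 (by linarith))
  have hab : Summable fun p : ℕ × ℕ => Real.exp (Real.pi * |n.im|) *
      (((1 / a ^ (n.re / 2)) * (1 / ((p.1 + 1 : ℕ) : ℝ) ^ (n.re / 2))) *
        ((1 / |b| ^ (n.re / 2)) * (1 / ((p.2 + 1 : ℕ) : ℝ) ^ (n.re / 2)))) :=
    ((hs.mul_left _).mul_of_nonneg (hs.mul_left _) (fun _ => by positivity)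
      (fun _ => by positivity)).mul_left _
  refine hab.of_norm_bounded fun p => ?_
  rw [fermiDoubleTerm, norm_mul]
  simp only [norm_pow, norm_neg, norm_one, one_pow, one_mul]
  refine (norm_one_div_cpow_le (by linarith) (by positivity)
    (mul_ne_zero hb (by positivity))).trans (le_of_eq ?_)
  rw [abs_mul, abs_of_pos (by positivity : (0 : ℝ) < (p.2 : ℝ) + 1), Real.mul_rpow ha.le
    (by positivity), Real.mul_rpow (abs_nonneg b) (by positivity)]
  push_cast
  simp only [one_div_mul_one_div]

theorem hasSum_neg_one_pow_mul_integral_fermi {n : ℂ} (hn : 2 < n.re) {a b : ℝ} (ha : 0 < a)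
    (hb : b ≠ 0) :
    HasSum (fun m : ℕ => (-1 : ℂ) ^ m * ∫ x in Set.Ioi (0 : ℝ),
      fermi n a x * Complex.exp (-(Complex.I * (b * ((m : ℝ) + 1) : ℝ) * x)))
      (Complex.Gamma n * fermiDoubleSum n a b) := by
  have h := ((summable_fermiDoubleTerm hn ha hb).hasSum.mul_left (Complex.Gamma n))
  -- The swap makes the frequency index m the outer one; the inner sum over l is then the expansion
  -- of one integral.
  rw [← (Equiv.prodComm ℕ ℕ).hasSum_iff] at h
  refine h.prod_fiberwise fun m => ?_
  refine ((hasSum_integral_fermi_mul_exp (by linarith) ha (b * ((m : ℝ) + 1))).mul_left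
    ((-1 : ℂ) ^ m)).congr_fun fun l => ?_
  simp only [Function.comp_apply, Equiv.prodComm_apply, Prod.swap_prod_mk, fermiDoubleTerm,
    pow_add]
  ring

theorem fermiDoubleSum_mul {n : ℂ} {t a : ℝ} (ht : 0 < t) (ha : 0 < a) (b : ℝ) :
    fermiDoubleSum n (t * a) (t * b) = (1 / (t : ℂ)) ^ n * fermiDoubleSum n a b := by
  rw [fermiDoubleSum, fermiDoubleSum, ← tsum_mul_left]
  refine tsum_congr fun p => ?_
  simp only [fermiDoubleTerm]
  have : (1 / (((t * a * ((p.1 : ℝ) + 1) : ℝ) : ℂ) + Complex.I * (t * b * ((p.2 : ℝ) + 1) : ℝ))) =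
      ((1 / t : ℝ) : ℂ) *
        (1 / (((a * ((p.1 : ℝ) + 1) : ℝ) : ℂ) + Complex.I * (b * ((p.2 : ℝ) + 1) : ℝ))) := by
    rw [Complex.ofReal_div, Complex.ofReal_one, one_div_mul_one_div]
    congr 1
    push_cast
    ring
  rw [this, mul_cpow_of_arg_add_mem (by exact_mod_cast (one_div_pos.2 ht).ne') (one_div_ne_zero ?_)]
  · push_cast; ring
  · rw [Complex.arg_ofReal_of_nonneg (by positivity), zero_add]
    exact Complex.arg_mem_Ioc _
  · intro h
    have := congrArg Complex.re h
    simp at this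
    rcases this with h | h
    · exact ha.ne' h
    · linarith [(p.1.cast_nonneg : (0:ℝ) ≤ p.1)]

/-- Termwise, a l - i b m = -i (b m + i a l), and 1/(-i) = i contributes the factor e^(iπn/2). -/
theorem fermiDoubleSum_swap_neg (n : ℂ) {a b : ℝ} (hb : 0 < b) :
    fermiDoubleSum n a (-b) =
      Complex.exp (Complex.I * (Real.pi * n / 2)) * fermiDoubleSum n b a := by
  rw [fermiDoubleSum, fermiDoubleSum, ← (Equiv.prodComm ℕ ℕ).tsum_eq, ← tsum_mul_left]
  refine tsum_congr fun p => ?_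
  simp only [Equiv.prodComm_apply, Prod.fst_swap, Prod.snd_swap, fermiDoubleTerm]
  set w : ℂ := ((b * ((p.1 : ℝ) + 1) : ℝ) : ℂ) + Complex.I * (a * ((p.2 : ℝ) + 1) : ℝ) with hw
  have hre : w.re = b * ((p.1 : ℝ) + 1) := by simp [hw]
  have hpos : 0 < w.re := by rw [hre]; positivity
  have hw0 : w ≠ 0 := by intro h; simp [h] at hpos
  have e : 1 / (((a * ((p.2 : ℝ) + 1) : ℝ) : ℂ) + Complex.I * (-b * ((p.1 : ℝ) + 1) : ℝ)) =
      Complex.I * (1 / w) := by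
    have : (((a * ((p.2 : ℝ) + 1) : ℝ) : ℂ) + Complex.I * (-b * ((p.1 : ℝ) + 1) : ℝ)) =
        -Complex.I * w := by
      rw [hw]
      push_cast
      linear_combination ((a : ℂ) * (p.2 + 1)) * Complex.I_mul_I
    rw [this, one_div, mul_inv, one_div, inv_neg, Complex.inv_I, neg_neg]
  rw [e, I_mul_cpow_of_re_nonneg (one_div_ne_zero hw0), add_comm p.2 p.1]
  · ring
  · rw [one_div, Complex.inv_re]
    exact div_nonneg hpos.le (Complex.normSq_nonneg _)

/-! ### Decay bounds and midpoint Poisson summation -/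

/-- This is y ≤ e^y at y = δx/a, raised to the power a. -/
theorem rpow_le_mul_exp {a : ℝ} (ha : 0 < a) {δ x : ℝ} (hδ : 0 < δ) (hx : 0 ≤ x) :
    x ^ a ≤ (a / δ) ^ a * Real.exp (δ * x) := by
  have h1 : x ≤ a / δ * Real.exp (δ * x / a) := by
    have := Real.add_one_le_exp (δ * x / a)
    calc x = a / δ * (δ * x / a) := by field_simp
      _ ≤ _ := by gcongr; linarith
  calc x ^ a ≤ (a / δ * Real.exp (δ * x / a)) ^ a := Real.rpow_le_rpow hx h1 ha.le
    _ = _ := by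
      rw [Real.mul_rpow (by positivity) (by positivity), ← Real.exp_mul]
      congr 2; field_simp

theorem norm_fermi_le (n : ℂ) (c : ℝ) {x : ℝ} (hx : 0 < x) :
    ‖fermi n c x‖ ≤ x ^ (n.re - 1) * Real.exp (-(c * x)) := by
  rw [fermi, norm_div, Complex.norm_cpow_eq_rpow_re_of_pos hx,
    Complex.norm_of_nonneg (by positivity), Real.exp_neg, ← div_eq_mul_inv]
  simp only [Complex.sub_re, Complex.one_re]
  gcongr
  linarith

/-- `fermi`, extended by zero to the negative half-line. -/
noncomputable def fermiExt (n : ℂ) (c : ℝ) : ℝ → ℂ := (Set.Ioi 0).indicator (fermi n c)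

/-- Because Re n > 1 the power vanishes at the origin, so replacing x by max(x, 0) in the numerator
performs the extension by zero. -/
theorem continuous_fermiExt {n : ℂ} (hn : 1 < n.re) (c : ℝ) : Continuous (fermiExt n c) := by
  have e : fermiExt n c =
      fun x : ℝ => ((max x 0 : ℝ) : ℂ) ^ (n - 1) / ((Real.exp (c * x) + 1 : ℝ) : ℂ) := by
    funext x
    by_cases hx : 0 < x
    · rw [fermiExt, Set.indicator_of_mem (Set.mem_Ioi.2 hx), max_eq_left hx.le, fermi]
    · have : n ≠ 1 := by rintro rfl; simp at hn
      rw [fermiExt, Set.indicator_of_notMem (by simpa using hx), max_eq_right (not_lt.1 hx),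
        Complex.ofReal_zero, Complex.zero_cpow (sub_ne_zero.2 this), zero_div]
  rw [e]
  refine Continuous.div ?_ (by fun_prop) fun x => ?_
  · exact (Complex.continuous_ofReal_cpow_const (by simpa using hn)).comp
      (continuous_id.max continuous_const)
  · exact_mod_cast (by positivity : Real.exp (c * x) + 1 ≠ 0)

theorem isBigO_fermiExt {n : ℂ} (hn : 1 < n.re) {c : ℝ} (hc : 0 < c) :
    fermiExt n c =O[cocompact ℝ] fun x : ℝ => |x| ^ (-2 : ℝ) := by
  refine Asymptotics.IsBigO.of_bound (((n.re + 1) / c) ^ (n.re + 1)) (Eventually.of_forall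
    fun x => ?_)
  rw [Real.norm_of_nonneg (by positivity)]
  by_cases hx : 0 < x
  · rw [fermiExt, Set.indicator_of_mem (Set.mem_Ioi.2 hx), abs_of_pos hx]
    refine (norm_fermi_le n c hx).trans ?_
    have h := rpow_le_mul_exp (by linarith : 0 < n.re + 1) hc hx.le
    have e : x ^ (n.re - 1) = x ^ (n.re + 1) * x ^ (-2 : ℝ) := by
      rw [← Real.rpow_add hx]; congr 1; ring
    calc _ = x ^ (n.re + 1) * (x ^ (-2 : ℝ) * Real.exp (-(c * x))) := by rw [e]; ring
      _ ≤ ((n.re + 1) / c) ^ (n.re + 1) * Real.exp (c * x) *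
          (x ^ (-2 : ℝ) * Real.exp (-(c * x))) := by gcongr
      _ = ((n.re + 1) / c) ^ (n.re + 1) * x ^ (-2 : ℝ) *
          (Real.exp (c * x) * Real.exp (-(c * x))) := by ring
      _ = _ := by rw [← Real.exp_add, add_neg_cancel, Real.exp_zero, mul_one]
  · rw [fermiExt, Set.indicator_of_notMem (by simpa using hx), norm_zero]
    have : 0 < n.re + 1 := by linarith
    positivity

theorem fourier_fermiExt (n : ℂ) (c w : ℝ) :
    FourierTransform.fourier (fermiExt n c) w = ∫ x in Set.Ioi (0 : ℝ),
      fermi n c x * Complex.exp (-(Complex.I * (2 * Real.pi * w : ℝ) * x)) := by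
  rw [Real.fourier_real_eq_integral_exp_smul, ← integral_indicator measurableSet_Ioi]
  congr 1
  funext x
  by_cases hx : x ∈ Set.Ioi (0 : ℝ)
  · rw [fermiExt, Set.indicator_of_mem hx, Set.indicator_of_mem hx, smul_eq_mul, mul_comm]
    congr 2
    push_cast
    ring
  · rw [fermiExt, Set.indicator_of_notMem hx, Set.indicator_of_notMem hx, smul_zero]

theorem norm_fermi_le_exp {n : ℂ} (hn : 1 < n.re) {c : ℝ} (hc : 0 < c) {x : ℝ} (hx : 0 < x) :
    ‖fermi n c x‖ ≤
      ((n.re - 1) / (c / 2)) ^ (n.re - 1) * Real.exp (-(c / 2 * x)) := by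
  refine (norm_fermi_le n c hx).trans ?_
  have h := rpow_le_mul_exp (by linarith : 0 < n.re - 1) (half_pos hc) hx.le
  calc _ ≤ ((n.re - 1) / (c / 2)) ^ (n.re - 1) * Real.exp (c / 2 * x) * Real.exp (-(c * x)) := by
        gcongr
    _ = _ := by rw [mul_assoc, ← Real.exp_add]; congr 2; ring

theorem halfIntTerm_eq_fermi (n : ℂ) (c : ℝ) (j : ℕ) :
    halfIntTerm n c j = fermi n c ((j : ℝ) + 1 / 2) := rfl

theorem summable_halfIntTerm {n : ℂ} (hn : 1 < n.re) {c : ℝ} (hc : 0 < c) :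
    Summable (halfIntTerm n c) := by
  have h1 : Summable fun j : ℕ => Real.exp (j * (-(c / 2))) :=
    Real.summable_exp_nat_mul_iff.2 (by linarith)
  refine (h1.mul_left (((n.re - 1) / (c / 2)) ^ (n.re - 1) *
    Real.exp (-(c / 2 * (1 / 2))))).of_norm_bounded fun j => ?_
  have h2 := norm_fermi_le_exp hn hc (by positivity : (0 : ℝ) < (j : ℝ) + 1 / 2)
  rw [← halfIntTerm_eq_fermi] at h2
  rw [mul_assoc, ← Real.exp_add]
  have e : -(c / 2 * (1 / 2)) + j * (-(c / 2)) = -(c / 2 * ((j : ℝ) + 1 / 2)) := by ring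
  rwa [e]

theorem integral_fermi {n : ℂ} (hn : 1 < n.re) {c : ℝ} (hc : 0 < c) :
    ∫ x in Set.Ioi (0 : ℝ), fermi n c x =
      Complex.Gamma n * ((1 - 2 ^ (1 - n)) * riemannZeta n) / (c : ℂ) ^ n := by
  have h1 := hasSum_integral_fermi_mul_exp hn hc 0
  simp only [Complex.ofReal_zero, mul_zero, zero_mul, neg_zero, Complex.exp_zero, mul_one,
    add_zero] at h1
  refine h1.unique ?_
  have h2 := (hasSum_neg_one_pow_mul_one_div_cpow hn).mul_left (Complex.Gamma n / (c : ℂ) ^ n)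
  rw [div_mul_eq_mul_div] at h2
  refine h2.congr_fun fun l => ?_
  rw [one_div, Complex.inv_cpow_ofReal_nonneg (by positivity), Complex.ofReal_mul,
    Complex.mul_cpow_ofReal_nonneg hc.le (by positivity)]
  push_cast
  rw [mul_inv]
  ring

/-- The midpoint Poisson summation formula for `fermi`. -/
theorem tsum_halfIntTerm {n : ℂ} (hn : 2 < n.re) {c : ℝ} (hc : 0 < c) :
    ∑' j : ℕ, halfIntTerm n c j =
      Complex.Gamma n * ((1 - 2 ^ (1 - n)) * riemannZeta n) / (c : ℂ) ^ n -
        Complex.Gamma n * (fermiDoubleSum n c (2 * Real.pi) +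
          fermiDoubleSum n c (-(2 * Real.pi))) := by
  set F := FourierTransform.fourier (fermiExt n c) with hF
  have hpi : 2 * Real.pi ≠ 0 := by positivity
  have hp : HasSum (fun m : ℕ => (-1 : ℂ) ^ m * F ((m + 1 : ℤ) : ℝ))
      (Complex.Gamma n * fermiDoubleSum n c (2 * Real.pi)) := by
    refine (hasSum_neg_one_pow_mul_integral_fermi hn hc hpi).congr_fun fun m => ?_
    rw [hF, fourier_fermiExt]
    push_cast
    rfl
  have hm : HasSum (fun m : ℕ => (-1 : ℂ) ^ m * F ((-(m + 1) : ℤ) : ℝ))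
      (Complex.Gamma n * fermiDoubleSum n c (-(2 * Real.pi))) := by
    refine (hasSum_neg_one_pow_mul_integral_fermi hn hc (neg_ne_zero.2 hpi)).congr_fun fun m => ?_
    rw [hF, fourier_fermiExt]
    congr! 6
    push_cast
    ring
  have hF0 : F ((0 : ℤ) : ℝ) =
      Complex.Gamma n * ((1 - 2 ^ (1 - n)) * riemannZeta n) / (c : ℂ) ^ n := by
    rw [hF, fourier_fermiExt, ← integral_fermi (by linarith) hc]
    simp
  -- The signs have modulus one, so summability of the two alternating halves gives that of F
  -- itself.
  have hsum : Summable fun m : ℤ => F m := by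
    refine Summable.of_add_one_of_neg_add_one ?_ ?_
    · refine Summable.of_norm (hp.summable.norm.congr fun m => ?_)
      simp
    · refine Summable.of_norm (hm.summable.norm.congr fun m => ?_)
      simp
  have hP := Real.tsum_eq_tsum_fourier_of_rpow_decay_of_summable
    (continuous_fermiExt (by linarith) c) one_lt_two (isBigO_fermiExt (by linarith) hc) hsum
    (1 / 2)
  -- Evaluation at 1/2 is what makes the dual series alternate.
  have hfour : ∀ m : ℤ, fourier m (((1 / 2 : ℝ)) : UnitAddCircle) = (-1 : ℂ) ^ m := by
    intro m
    rw [fourier_coe_apply, ← Complex.exp_pi_mul_I, ← Complex.exp_int_mul]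
    congr 1
    push_cast
    ring
  simp_rw [hfour] at hP
  have hleft : HasSum (fun j : ℤ => fermiExt n c (1 / 2 + j)) (∑' j : ℕ, halfIntTerm n c j + 0) := by
    refine HasSum.of_nat_of_neg_add_one ?_ ?_
    · refine (summable_halfIntTerm (by linarith) hc).hasSum.congr_fun fun j => ?_
      rw [fermiExt, Set.indicator_of_mem, add_comm]
      · exact halfIntTerm_eq_fermi n c j
      · exact Set.mem_Ioi.2 (by push_cast; positivity)
    · refine hasSum_zero.congr_fun fun j => ?_
      rw [fermiExt, Set.indicator_of_notMem]
      have : (0 : ℝ) ≤ j := j.cast_nonneg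
      simp only [Set.mem_Ioi, not_lt]
      push_cast
      linarith
  have hright : HasSum (fun m : ℤ => F m * (-1 : ℂ) ^ m)
      (-(Complex.Gamma n * fermiDoubleSum n c (2 * Real.pi)) + F ((0 : ℤ) : ℝ) * (-1) ^ (0 : ℤ) +
        -(Complex.Gamma n * fermiDoubleSum n c (-(2 * Real.pi)))) := by
    refine HasSum.of_add_one_of_neg_add_one ?_ ?_
    · refine hp.neg.congr_fun fun m => ?_
      -- Index m stands for frequency m + 1; this is the source of the minus sign before the double
      -- sums.
      have : (-1 : ℂ) ^ ((m : ℤ) + 1) = -(-1) ^ m := by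
        rw [← Nat.cast_succ, zpow_natCast, pow_succ]; ring
      rw [this]; ring
    · refine hm.neg.congr_fun fun m => ?_
      have : (-1 : ℂ) ^ (-((m : ℤ) + 1)) = -(-1) ^ m := by
        rw [zpow_neg, ← inv_zpow, inv_neg_one, ← Nat.cast_succ, zpow_natCast, pow_succ]; ring
      rw [this]; ring
  rw [hleft.tsum_eq, hright.tsum_eq, add_zero, hF0, zpow_zero] at hP
  rw [hP]
  ring

/-! ### Cells centred at the poles of the tangent -/

/-- The midpoint of the cell `[k T, (k + 1) T)` that contains `z`. -/
noncomputable def cellMid (T z : ℝ) : ℝ := T * (⌊z / T⌋ + 1 / 2)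

theorem measurable_cellMid (T : ℝ) : Measurable (cellMid T) := by
  unfold cellMid
  have : Measurable fun z : ℝ => ((⌊z / T⌋ : ℤ) : ℝ) :=
    (measurable_of_countable (fun k : ℤ => (k : ℝ))).comp
      (Int.measurable_floor.comp (measurable_id.div_const T))
  exact (this.add_const _).const_mul T

theorem abs_sub_cellMid_le {T : ℝ} (hT : 0 < T) (z : ℝ) : |z - cellMid T z| ≤ T / 2 := by
  have h1 := (le_div_iff₀ hT).1 (Int.floor_le (z / T))
  have h2 := (div_lt_iff₀ hT).1 (Int.lt_floor_add_one (z / T))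
  rw [cellMid, abs_le]
  constructor <;> nlinarith

theorem cellMid_pos {T z : ℝ} (hT : 0 < T) (hz : 0 < z) : 0 < cellMid T z := by
  have : (0 : ℝ) ≤ ⌊z / T⌋ := by exact_mod_cast Int.floor_nonneg.2 (by positivity)
  rw [cellMid]
  positivity

theorem cellMid_eq_of_mem_Ioo {T z : ℝ} (hT : 0 < T) {k : ℕ}
    (hz : z ∈ Set.Ioo (k * T) ((k + 1) * T)) : cellMid T z = T * (k + 1 / 2) := by
  have : ⌊z / T⌋ = (k : ℤ) := by
    rw [Int.floor_eq_iff]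
    push_cast
    exact ⟨((lt_div_iff₀ hT).2 hz.1).le, (div_lt_iff₀ hT).2 hz.2⟩
  rw [cellMid, this]
  push_cast
  rfl

theorem abs_cos_eq_abs_sin_sub_cellMid {β : ℝ} (hβ : 0 < β) (z : ℝ) :
    |Real.cos (β * z / 2)| = |Real.sin (β / 2 * (z - cellMid (2 * Real.pi / β) z))| := by
  set k := ⌊z / (2 * Real.pi / β)⌋ with hk
  have e : β * z / 2 = β / 2 * (z - cellMid (2 * Real.pi / β) z) + Real.pi / 2 + k * Real.pi := by
    rw [cellMid, ← hk]
    field_simp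
    ring
  rw [e, Real.cos_add_int_mul_pi, Real.cos_add_pi_div_two]
  rw [abs_mul, abs_neg, abs_zpow, abs_neg, abs_one, one_zpow, one_mul]

/-- Jordan's inequality |sin x| ≥ 2|x|/π, valid since β/2 times the distance to the midpoint is at
most π/2. -/
theorem mul_abs_sub_cellMid_le_abs_cos {β : ℝ} (hβ : 0 < β) (z : ℝ) :
    β / Real.pi * |z - cellMid (2 * Real.pi / β) z| ≤ |Real.cos (β * z / 2)| := by
  have hpi := Real.pi_pos
  have h1 := abs_sub_cellMid_le (by positivity : 0 < 2 * Real.pi / β) z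
  rw [abs_cos_eq_abs_sin_sub_cellMid hβ]
  refine le_trans (le_of_eq ?_) (Real.mul_abs_le_abs_sin ?_)
  · rw [abs_mul, abs_of_pos (half_pos hβ)]
    field_simp
  · rw [abs_mul, abs_of_pos (half_pos hβ)]
    calc _ ≤ β / 2 * (2 * Real.pi / β / 2) := by gcongr
      _ = _ := by field_simp

theorem cos_cellMid_eq_zero {β : ℝ} (hβ : 0 < β) (z : ℝ) :
    Real.cos (β * cellMid (2 * Real.pi / β) z / 2) = 0 := by
  rw [Real.cos_eq_zero_iff]
  refine ⟨⌊z / (2 * Real.pi / β)⌋, ?_⟩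
  rw [cellMid]
  field_simp

/-- The pole nearest to z is the midpoint of its own cell: any other is at least T = 2π/β from that
midpoint, hence at least T/2 from z. The removed set is thus described by one distance, whatever the
size of ε. -/
theorem mem_iUnion_tanPoles_iff {β : ℝ} (hβ : 0 < β) {z : ℝ} (hz : 0 < z) (ε : ℝ) :
    z ∈ ⋃ s ∈ tanPoles β, Set.Ioo (s - ε) (s + ε) ↔
      |z - cellMid (2 * Real.pi / β) z| < ε := by
  have hT : 0 < 2 * Real.pi / β := by have := Real.pi_pos; positivity
  simp only [Set.mem_iUnion, exists_prop]
  constructor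
  · rintro ⟨s, ⟨_, hs⟩, h1⟩
    have h1' : |z - s| < ε := by
      rw [abs_lt]; exact ⟨by linarith [h1.1], by linarith [h1.2]⟩
    refine lt_of_le_of_lt ?_ h1'
    obtain ⟨k, hk⟩ := Real.cos_eq_zero_iff.1 hs
    have hs' : s = 2 * Real.pi / β * (k + 1 / 2) := by
      field_simp
      field_simp at hk
      linarith
    rcases eq_or_ne k ⌊z / (2 * Real.pi / β)⌋ with rfl | hne
    · rw [hs', cellMid]
    · have h2 := abs_sub_cellMid_le hT z
      have h3 : 2 * Real.pi / β ≤ |s - cellMid (2 * Real.pi / β) z| := by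
        rw [hs', cellMid, ← mul_sub, abs_mul, abs_of_pos hT]
        have : (1 : ℝ) ≤ |(k : ℝ) + 1 / 2 - (⌊z / (2 * Real.pi / β)⌋ + 1 / 2)| := by
          rw [add_sub_add_right_eq_sub]
          exact_mod_cast Int.one_le_abs (sub_ne_zero.2 hne)
        exact le_mul_of_one_le_right hT.le this
      have h4 := abs_sub_le s z (cellMid (2 * Real.pi / β) z)
      rw [abs_sub_comm s z] at h4
      linarith
  · intro h
    refine ⟨cellMid (2 * Real.pi / β) z, ⟨cellMid_pos hT hz, cos_cellMid_eq_zero hβ z⟩, ?_⟩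
    rw [abs_lt] at h
    exact ⟨by linarith [h.2], by linarith [h.1]⟩

/-- Reflection about its midpoint shows that the integral over each cell equals its own negative;
the cells exhaust the half-line. Open cells suffice because endpoints are null. -/
theorem setIntegral_Ioi_eq_zero_of_odd_on_cells {F : ℝ → ℂ} {T : ℝ} (hT : 0 < T)
    (hF : IntegrableOn F (Set.Ioi 0))
    (hodd : ∀ k : ℕ, ∀ z ∈ Set.Ioo (k * T) ((k + 1) * T), F ((2 * k + 1) * T - z) = -F z) :
    ∫ z in Set.Ioi (0 : ℝ), F z = 0 := by
  have hcell : ∀ k : ℕ, ∫ z in (k * T)..((k + 1 : ℕ) * T), F z = 0 := by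
    intro k
    have h1 : ∫ z in (k * T)..((k + 1 : ℕ) * T), F ((2 * k + 1) * T - z) =
        ∫ z in (k * T)..((k + 1 : ℕ) * T), F z := by
      rw [intervalIntegral.integral_comp_sub_left]
      congr 1 <;> push_cast <;> ring
    have h2 : ∫ z in (k * T)..((k + 1 : ℕ) * T), F ((2 * k + 1) * T - z) =
        ∫ z in (k * T)..((k + 1 : ℕ) * T), -F z := by
      refine intervalIntegral.integral_congr_Ioo_of_le (by gcongr; simp) fun z hz => hodd k z ?_
      simpa using hz
    rw [h1, intervalIntegral.integral_neg] at h2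
    exact self_eq_neg.1 h2
  have hlim := intervalIntegral_tendsto_integral_Ioi (0 : ℝ) hF
    (tendsto_natCast_atTop_atTop.atTop_mul_const hT : Tendsto (fun k : ℕ => (k : ℝ) * T) atTop atTop)
  refine tendsto_nhds_unique hlim (tendsto_const_nhds.congr fun N => ?_)
  have hs := intervalIntegral.sum_integral_adjacent_intervals (f := F) (μ := volume)
    (a := fun k : ℕ => (k : ℝ) * T) (n := N) (fun k _ => by
      rw [intervalIntegrable_iff_integrableOn_Ioc_of_le (by gcongr; simp)]
      refine hF.mono_set fun z hz => ?_
      exact lt_of_le_of_lt (by positivity) hz.1)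
  simp only [Nat.cast_zero, zero_mul] at hs
  rw [← hs]
  exact (Finset.sum_eq_zero fun k _ => hcell k).symm

/-! ### Riemann-Lebesgue and the alternating sine kernel -/

/-- The Riemann-Lebesgue lemma for the sine transform on the half-line. -/
theorem tendsto_setIntegral_mul_sin {h : ℝ → ℂ} (hh : IntegrableOn h (Set.Ioi 0)) :
    Tendsto (fun w : ℝ => ∫ z in Set.Ioi (0 : ℝ), h z * (Real.sin (w * z) : ℂ)) atTop (𝓝 0) := by
  have hRL := Real.tendsto_integral_exp_smul_cocompact ((Set.Ioi (0 : ℝ)).indicator h)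
  have e : ∀ w : ℝ, ∫ v : ℝ, Real.fourierChar (-(v * w)) • (Set.Ioi (0 : ℝ)).indicator h v =
      ∫ v in Set.Ioi (0 : ℝ), h v * Complex.exp (-(2 * Real.pi * w * v) * Complex.I) := by
    intro w
    rw [← integral_indicator measurableSet_Ioi]
    congr 1
    funext v
    by_cases hv : v ∈ Set.Ioi (0 : ℝ)
    · rw [Set.indicator_of_mem hv, Set.indicator_of_mem hv, Circle.smul_def,
        Real.fourierChar_apply, smul_eq_mul, mul_comm]
      congr 2
      push_cast
      ring
    · rw [Set.indicator_of_notMem hv, Set.indicator_of_notMem hv, smul_zero]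
  simp_rw [e] at hRL
  have hc : (2 * Real.pi) > 0 := by have := Real.pi_pos; positivity
  have t1 : Tendsto (fun w : ℝ => w / (2 * Real.pi)) atTop (cocompact ℝ) :=
    (tendsto_id.atTop_div_const hc).mono_right atTop_le_cocompact
  have t2 : Tendsto (fun w : ℝ => -(w / (2 * Real.pi))) atTop (cocompact ℝ) :=
    (tendsto_neg_atTop_atBot.comp (tendsto_id.atTop_div_const hc)).mono_right atBot_le_cocompact
  -- The sine is a combination of the Fourier characters at frequencies ±w/(2π).
  have hlim := ((hRL.comp t1).sub (hRL.comp t2)).mul_const (Complex.I / 2)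
  rw [sub_zero, zero_mul] at hlim
  refine hlim.congr fun w => ?_
  have hint : ∀ u : ℝ, IntegrableOn
      (fun v : ℝ => h v * Complex.exp (-(2 * Real.pi * u * v) * Complex.I)) (Set.Ioi 0) := by
    intro u
    refine Integrable.mul_bdd (c := 1) hh (by fun_prop) (Eventually.of_forall fun v => ?_)
    rw [Complex.norm_exp]
    simp
  simp only [Function.comp_apply]
  rw [← integral_sub (hint _) (hint _), ← integral_mul_const]
  congr 1
  funext v
  rw [← mul_sub, mul_assoc]
  congr 1
  have hpi : (Real.pi : ℂ) ≠ 0 := by exact_mod_cast Real.pi_ne_zero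
  rw [Complex.ofReal_sin, Complex.sin]
  push_cast
  have e1 : -(2 * (Real.pi : ℂ) * (w / (2 * Real.pi)) * v) * Complex.I = -(w * v) * Complex.I := by
    field_simp
  have e2 : -(2 * (Real.pi : ℂ) * -(w / (2 * Real.pi)) * v) * Complex.I = w * v * Complex.I := by
    field_simp
  rw [e1, e2]
  ring

theorem cos_half_mul_sum_sin (θ : ℝ) (N : ℕ) :
    Real.cos (θ / 2) * ∑ l ∈ Finset.range N, 2 * (-1) ^ l * Real.sin ((l + 1) * θ) =
      Real.sin (θ / 2) - (-1) ^ N * Real.sin ((N + 1 / 2) * θ) := by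
  induction N with
  | zero => simp [div_eq_inv_mul]
  | succ N ih =>
    rw [Finset.sum_range_succ, mul_add, ih]
    have h1 : Real.sin (((N + 1 : ℕ) + 1 / 2) * θ) =
        Real.sin ((N + 1) * θ) * Real.cos (θ / 2) + Real.cos ((N + 1) * θ) * Real.sin (θ / 2) := by
      rw [← Real.sin_add]; congr 1; push_cast; ring
    have h2 : Real.sin ((N + 1 / 2) * θ) =
        Real.sin ((N + 1) * θ) * Real.cos (θ / 2) - Real.cos ((N + 1) * θ) * Real.sin (θ / 2) := by
      rw [← Real.sin_sub]; congr 1; ring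
    rw [h1, h2, pow_succ]
    ring

/-! ### Removing the poles and evaluating the principal value -/

/-- Mean value inequality on a convex set containing both points, all of it at or beyond z - T/2;
hence the loss e^(δT/2). -/
theorem norm_sub_cellMid_le {g g' : ℝ → ℂ} {C δ T : ℝ} (hT : 0 < T) (hC : 0 ≤ C) (hδ : 0 < δ)
    (hg : ∀ z, 0 < z → HasDerivAt g (g' z) z)
    (hb : ∀ z, 0 < z → ‖g' z‖ ≤ C * Real.exp (-(δ * z))) {z : ℝ} (hz : 0 < z) :
    ‖g z - g (cellMid T z)‖ ≤
      C * Real.exp (δ * (T / 2)) * Real.exp (-(δ * z)) * |z - cellMid T z| := by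
  have hp := cellMid_pos hT hz
  have hle := abs_le.1 (abs_sub_cellMid_le hT z)
  set s := Set.Ioi (0 : ℝ) ∩ Set.Ici (z - T / 2) with hs
  have hconv : Convex ℝ s := (convex_Ioi 0).inter (convex_Ici _)
  refine hconv.norm_image_sub_le_of_norm_hasDerivWithin_le (f' := g')
    (fun x hx => (hg x hx.1).hasDerivWithinAt) (fun x hx => ?_)
    ⟨hp, by simp only [Set.mem_Ici]; linarith⟩ ⟨hz, by simp only [Set.mem_Ici]; linarith⟩
  refine (hb x hx.1).trans ?_
  rw [mul_assoc, ← Real.exp_add]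
  have : z - T / 2 ≤ x := hx.2
  gcongr
  nlinarith

theorem norm_cellMid_le {g : ℝ → ℂ} {C δ T : ℝ} (hT : 0 < T) (hC : 0 ≤ C) (hδ : 0 < δ)
    (hb : ∀ z, 0 < z → ‖g z‖ ≤ C * Real.exp (-(δ * z))) {z : ℝ} (hz : 0 < z) :
    ‖g (cellMid T z)‖ ≤ C * Real.exp (δ * (T / 2)) * Real.exp (-(δ * z)) := by
  refine (hb _ (cellMid_pos hT hz)).trans ?_
  have hle := abs_le.1 (abs_sub_cellMid_le hT z)
  rw [mul_assoc, ← Real.exp_add]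
  gcongr
  nlinarith

theorem integrableOn_of_norm_le_exp {f : ℝ → ℂ} (hf : Measurable f) {C δ : ℝ} (hδ : 0 < δ)
    (hb : ∀ z, 0 < z → ‖f z‖ ≤ C * Real.exp (-(δ * z))) : IntegrableOn f (Set.Ioi 0) := by
  have h1 : IntegrableOn (fun z : ℝ => C * Real.exp (-(δ * z))) (Set.Ioi 0) := by
    have h := (exp_neg_integrableOn_Ioi 0 hδ).const_mul C
    simp only [neg_mul] at h
    exact h
  refine h1.mono' hf.aestronglyMeasurable ?_
  filter_upwards [ae_restrict_mem measurableSet_Ioi] with z hz using hb z hz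

/-- The Dirichlet-type partial sums `2 ∑_{l < N} (-1) ^ l sin ((l + 1) θ)`. -/
noncomputable def altSinSum (N : ℕ) (θ : ℝ) : ℝ :=
  ∑ l ∈ Finset.range N, 2 * (-1) ^ l * Real.sin ((l + 1) * θ)

theorem continuous_altSinSum (N : ℕ) : Continuous (altSinSum N) := by
  unfold altSinSum
  fun_prop

theorem abs_altSinSum_le (N : ℕ) (θ : ℝ) : |altSinSum N θ| ≤ N * 2 := by
  refine (Finset.abs_sum_le_sum_abs _ _).trans ?_
  refine (Finset.sum_le_card_nsmul _ _ 2 fun l _ => ?_).trans (by simp)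
  rw [abs_mul, abs_mul, abs_pow, abs_neg, abs_one, one_pow, mul_one, abs_two]
  linarith [Real.abs_sin_le_one ((l + 1) * θ)]

/-- `g` minus its value at the midpoint of the cell, divided by `cos (β z / 2)`. -/
noncomputable def cellQuot (g : ℝ → ℂ) (β z : ℝ) : ℂ :=
  (g z - g (cellMid (2 * Real.pi / β) z)) / (Real.cos (β * z / 2) : ℂ)

theorem measurable_cellQuot {g : ℝ → ℂ} (hg : Measurable g) (β : ℝ) : Measurable (cellQuot g β) := by
  unfold cellQuot
  have := hg.comp (measurable_cellMid (2 * Real.pi / β))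
  exact (hg.sub this).div (by fun_prop)

theorem eq_cellMid_of_cos_eq_zero {β : ℝ} (hβ : 0 < β) {z : ℝ} (hz : Real.cos (β * z / 2) = 0) :
    cellMid (2 * Real.pi / β) z = z := by
  have h1 := mul_abs_sub_cellMid_le_abs_cos hβ z
  rw [hz, abs_zero] at h1
  have h2 : 0 < β / Real.pi := by have := Real.pi_pos; positivity
  have h3 : |z - cellMid (2 * Real.pi / β) z| ≤ 0 := by
    by_contra h
    push Not at h
    linarith [mul_pos h2 h]
  exact (sub_eq_zero.1 (abs_nonpos_iff.1 h3)).symm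

theorem cellQuot_mul_cos {β : ℝ} (hβ : 0 < β) (g : ℝ → ℂ) (z : ℝ) :
    cellQuot g β z * (Real.cos (β * z / 2) : ℂ) = g z - g (cellMid (2 * Real.pi / β) z) := by
  by_cases hc : Real.cos (β * z / 2) = 0
  · rw [hc, eq_cellMid_of_cos_eq_zero hβ hc]; simp
  · rw [cellQuot, div_mul_cancel₀ _ (by exact_mod_cast hc)]

/-- The numerator is at most a multiple of the distance to the pole and the cosine at least another
multiple, so the singularity cancels and the exponential decay survives. -/
theorem norm_cellQuot_le {g g' : ℝ → ℂ} {C δ β : ℝ} (hβ : 0 < β) (hC : 0 ≤ C) (hδ : 0 < δ)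
    (hg : ∀ z, 0 < z → HasDerivAt g (g' z) z)
    (hb : ∀ z, 0 < z → ‖g' z‖ ≤ C * Real.exp (-(δ * z))) {z : ℝ} (hz : 0 < z) :
    ‖cellQuot g β z‖ ≤
      C * Real.exp (δ * (2 * Real.pi / β / 2)) * (Real.pi / β) * Real.exp (-(δ * z)) := by
  have hpi := Real.pi_pos
  have hT : 0 < 2 * Real.pi / β := by positivity
  rw [cellQuot, norm_div, Complex.norm_real, Real.norm_eq_abs]
  refine div_le_of_le_mul₀ (abs_nonneg _) (by positivity) ?_
  refine (norm_sub_cellMid_le hT hC hδ hg hb hz).trans ?_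
  have h1 := mul_abs_sub_cellMid_le_abs_cos hβ z
  calc _ = C * Real.exp (δ * (2 * Real.pi / β / 2)) * (Real.pi / β) * Real.exp (-(δ * z)) *
        (β / Real.pi * |z - cellMid (2 * Real.pi / β) z|) := by field_simp
    _ ≤ _ := by gcongr

theorem setIntegral_cellMid_mul_eq_zero {g : ℝ → ℂ} {T : ℝ} (hT : 0 < T) {w : ℝ → ℝ}
    (hint : IntegrableOn (fun z => g (cellMid T z) * (w z : ℂ)) (Set.Ioi 0))
    (hw : ∀ k : ℕ, ∀ z ∈ Set.Ioo (k * T) ((k + 1) * T), w ((2 * k + 1) * T - z) = -w z) :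
    ∫ z in Set.Ioi (0 : ℝ), g (cellMid T z) * (w z : ℂ) = 0 := by
  refine setIntegral_Ioi_eq_zero_of_odd_on_cells hT hint fun k z hz => ?_
  have hz' : (2 * k + 1) * T - z ∈ Set.Ioo (k * T) ((k + 1) * T) :=
    ⟨by linarith [hz.2], by linarith [hz.1]⟩
  rw [hw k z hz, cellMid_eq_of_mem_Ioo hT hz, cellMid_eq_of_mem_Ioo hT hz']
  push_cast
  ring

/-- The part of the line at distance at least `ε` from the midpoint of its cell. -/
def farFromMid (β ε : ℝ) : Set ℝ := {z | ε ≤ |z - cellMid (2 * Real.pi / β) z|}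

theorem measurableSet_farFromMid (β ε : ℝ) : MeasurableSet (farFromMid β ε) :=
  measurableSet_le measurable_const
    (measurable_id.sub (measurable_cellMid _)).norm

theorem Ioi_diff_iUnion_tanPoles {β : ℝ} (hβ : 0 < β) (ε : ℝ) :
    Set.Ioi 0 \ ⋃ s ∈ tanPoles β, Set.Ioo (s - ε) (s + ε) = Set.Ioi 0 ∩ farFromMid β ε := by
  ext z
  refine and_congr_right fun hz => ?_
  rw [mem_iUnion_tanPoles_iff hβ hz, not_lt]
  rfl

theorem abs_indicator_tan_le {β : ℝ} (hβ : 0 < β) {ε : ℝ} (hε : 0 < ε) (z : ℝ) :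
    |(farFromMid β ε).indicator (fun z => Real.tan (β * z / 2)) z| ≤ Real.pi / (β * ε) := by
  have hpi := Real.pi_pos
  by_cases hz : z ∈ farFromMid β ε
  · rw [Set.indicator_of_mem hz, Real.tan_eq_sin_div_cos, abs_div]
    have h1 := mul_abs_sub_cellMid_le_abs_cos hβ z
    have h2 : β / Real.pi * ε ≤ |Real.cos (β * z / 2)| :=
      le_trans (mul_le_mul_of_nonneg_left hz (by positivity)) h1
    calc _ ≤ 1 / (β / Real.pi * ε) :=
          div_le_div₀ zero_le_one (Real.abs_sin_le_one _) (by positivity) h2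
      _ = _ := by field_simp
  · rw [Set.indicator_of_notMem hz, abs_zero]; positivity

theorem indicator_tan_reflect {β : ℝ} (hβ : 0 < β) (ε : ℝ) (k : ℕ) {z : ℝ}
    (hz : z ∈ Set.Ioo (k * (2 * Real.pi / β)) ((k + 1) * (2 * Real.pi / β))) :
    (farFromMid β ε).indicator (fun z => Real.tan (β * z / 2))
      ((2 * k + 1) * (2 * Real.pi / β) - z) =
    -(farFromMid β ε).indicator (fun z => Real.tan (β * z / 2)) z := by
  have hT : 0 < 2 * Real.pi / β := by have := Real.pi_pos; positivity
  set T := 2 * Real.pi / β with hTd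
  have hz' : (2 * k + 1) * T - z ∈ Set.Ioo (k * T) ((k + 1) * T) :=
    ⟨by linarith [hz.2], by linarith [hz.1]⟩
  have hmem : (2 * k + 1) * T - z ∈ farFromMid β ε ↔ z ∈ farFromMid β ε := by
    simp only [farFromMid, Set.mem_ofPred_eq, ← hTd]
    rw [cellMid_eq_of_mem_Ioo hT hz, cellMid_eq_of_mem_Ioo hT hz', ← abs_neg]
    ring_nf
  by_cases h : z ∈ farFromMid β ε
  · rw [Set.indicator_of_mem h, Set.indicator_of_mem (hmem.2 h)]
    have : β * ((2 * k + 1) * T - z) / 2 = -(β * z / 2) + ((2 * k + 1 : ℕ) : ℝ) * Real.pi := by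
      rw [hTd]; push_cast; field_simp; ring
    rw [this, Real.tan_add_nat_mul_pi, Real.tan_neg]
  · rw [Set.indicator_of_notMem h, Set.indicator_of_notMem (fun h' => h (hmem.1 h')), neg_zero]

theorem altSinSum_reflect {β : ℝ} (hβ : 0 < β) (N k : ℕ) (z : ℝ) :
    altSinSum N (β * ((2 * k + 1) * (2 * Real.pi / β) - z)) = -altSinSum N (β * z) := by
  rw [altSinSum, altSinSum, ← Finset.sum_neg_distrib]
  refine Finset.sum_congr rfl fun l _ => ?_
  have : ((l : ℝ) + 1) * (β * ((2 * k + 1) * (2 * Real.pi / β) - z)) =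
      ((l + 1) * (2 * k + 1) : ℕ) * (2 * Real.pi) - (l + 1) * (β * z) := by
    push_cast; field_simp
  rw [this, Real.sin_nat_mul_two_pi_sub]
  ring

/-- Write g = h cos(βz/2) + g(mid), with h = `cellQuot g β` integrable. Against the truncated
tangent, and against the sine sums, the g(mid) part is odd on cells and integrates to zero. What
remains is h sin(βz/2), up to truncation in one case and up to a Riemann-Lebesgue remainder in the
other, so both limits are the integral of h sin(βz/2). -/
theorem exists_hasCauchyPV_tan {g g' : ℝ → ℂ} {C δ β : ℝ} (hβ : 0 < β) (hC : 0 ≤ C) (hδ : 0 < δ)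
    (hm : Measurable g) (hg : ∀ z, 0 < z → HasDerivAt g (g' z) z)
    (hb : ∀ z, 0 < z → ‖g z‖ ≤ C * Real.exp (-(δ * z)))
    (hb' : ∀ z, 0 < z → ‖g' z‖ ≤ C * Real.exp (-(δ * z))) :
    ∃ I : ℂ, HasCauchyPV (fun z => g z * ((Real.tan (β * z / 2) : ℝ) : ℂ)) (Set.Ioi 0)
        (tanPoles β) I ∧
      Tendsto (fun N : ℕ => ∫ z in Set.Ioi (0 : ℝ), g z * (altSinSum N (β * z) : ℂ))
        atTop (𝓝 I) := by
  have hpi := Real.pi_pos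
  have hT : 0 < 2 * Real.pi / β := by positivity
  set T := 2 * Real.pi / β with hTd
  set h := cellQuot g β with hh
  have hgi : IntegrableOn g (Set.Ioi 0) := integrableOn_of_norm_le_exp hm hδ hb
  have hpm : Measurable fun z => g (cellMid T z) := hm.comp (measurable_cellMid T)
  have hpi' : IntegrableOn (fun z => g (cellMid T z)) (Set.Ioi 0) :=
    integrableOn_of_norm_le_exp hpm hδ fun z hz => norm_cellMid_le hT hC hδ hb hz
  have hhm : Measurable h := measurable_cellQuot hm β
  have hhi : IntegrableOn h (Set.Ioi 0) :=
    integrableOn_of_norm_le_exp hhm hδ fun z hz => norm_cellQuot_le hβ hC hδ hg hb' hz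
  have hbdd : ∀ {f : ℝ → ℂ} {w : ℝ → ℝ} {c : ℝ}, IntegrableOn f (Set.Ioi 0) → Measurable w →
      (∀ z, |w z| ≤ c) → IntegrableOn (fun z => f z * (w z : ℂ)) (Set.Ioi 0) := by
    intro f w c hf hw hc
    refine Integrable.mul_bdd (c := c) hf
      (Complex.measurable_ofReal.comp hw).aestronglyMeasurable (Eventually.of_forall fun z => ?_)
    rw [Complex.norm_real]
    exact hc z
  have htm : ∀ ε : ℝ, Measurable ((farFromMid β ε).indicator fun z => Real.tan (β * z / 2)) :=
    fun ε => by
      refine Measurable.indicator ?_ (measurableSet_farFromMid β ε)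
      simp_rw [Real.tan_eq_sin_div_cos]
      fun_prop
  have hsm : ∀ c : ℝ, Measurable fun z : ℝ => Real.sin (c * z) := fun c => by fun_prop
  have hsm1 : ∀ (c : ℝ) (z : ℝ), |Real.sin (c * z)| ≤ 1 := fun c z => Real.abs_sin_le_one _
  have hsplit : ∀ z : ℝ, g z = h z * (Real.cos (β * z / 2) : ℂ) + g (cellMid T z) := fun z => by
    rw [hh, cellQuot_mul_cos hβ, sub_add_cancel]
  refine ⟨∫ z in Set.Ioi (0 : ℝ), h z * (Real.sin (β / 2 * z) : ℂ), ⟨fun ε hε => ?_, ?_⟩, ?_⟩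
  · rw [Ioi_diff_iUnion_tanPoles hβ]
    refine ((hbdd hgi (htm ε) (abs_indicator_tan_le hβ hε)).mono_set
      Set.inter_subset_left).congr_fun (fun z hz => ?_)
      (measurableSet_Ioi.inter (measurableSet_farFromMid β ε))
    simp only [Set.indicator_of_mem hz.2]
  · have hPV : ∀ ε : ℝ, 0 < ε →
        ∫ z in Set.Ioi (0 : ℝ), (farFromMid β ε).indicator
          (fun z => h z * (Real.sin (β / 2 * z) : ℂ)) z =
        ∫ z in Set.Ioi 0 \ ⋃ s ∈ tanPoles β, Set.Ioo (s - ε) (s + ε),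
          g z * ((Real.tan (β * z / 2) : ℝ) : ℂ) := by
      intro ε hε
      -- The midpoint part has integral zero, so it may be added to complete h sin to g tan away
      -- from the poles.
      have hI := hbdd hpi' (htm ε) (abs_indicator_tan_le hβ hε)
      have h0 := setIntegral_cellMid_mul_eq_zero hT hI
        fun k z hz => indicator_tan_reflect hβ ε k hz
      rw [Ioi_diff_iUnion_tanPoles hβ, ← setIntegral_indicator (measurableSet_farFromMid β ε),
        ← add_zero (∫ z in Set.Ioi (0 : ℝ), _), ← h0, ← integral_add _ hI]
      · congr 1
        funext z
        by_cases hz : z ∈ farFromMid β ε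
        · simp only [Set.indicator_of_mem hz]
          have hcos : Real.cos (β * z / 2) ≠ 0 := by
            intro hc
            have h1 : ε ≤ |z - cellMid T z| := hz
            rw [eq_cellMid_of_cos_eq_zero hβ hc, sub_self, abs_zero] at h1
            linarith
          have hcos' : (Real.cos (β * z / 2) : ℂ) ≠ 0 := by exact_mod_cast hcos
          conv_rhs => rw [hsplit z]
          rw [add_mul, Real.tan_eq_sin_div_cos, Complex.ofReal_div, mul_assoc (h z),
            mul_div_cancel₀ _ hcos', mul_div_right_comm]
        · simp only [Set.indicator_of_notMem hz, Complex.ofReal_zero, mul_zero, add_zero]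
      · exact (hbdd hhi (hsm _) (hsm1 _)).indicator (measurableSet_farFromMid β ε)
    refine Tendsto.congr' (eventually_nhdsWithin_of_forall hPV) ?_
    refine tendsto_integral_filter_of_dominated_convergence (fun z => ‖h z‖)
      (Eventually.of_forall fun ε => ?_) (Eventually.of_forall fun ε => ?_) hhi.norm ?_
    · exact ((hhm.mul (Complex.measurable_ofReal.comp (hsm _))).indicator
        (measurableSet_farFromMid β ε)).aestronglyMeasurable
    · refine Eventually.of_forall fun z => (norm_indicator_le_norm_self _ _).trans ?_
      rw [norm_mul, Complex.norm_real]
      exact mul_le_of_le_one_right (norm_nonneg _) (hsm1 _ z)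
    -- At a midpoint h vanishes; elsewhere the truncation is inactive once ε is below the distance
    -- to the midpoint.
    · refine Eventually.of_forall fun z => tendsto_const_nhds.congr' ?_
      by_cases hz : cellMid T z = z
      · have : h z = 0 := by rw [hh, cellQuot, ← hTd, hz, sub_self, zero_div]
        refine Eventually.of_forall fun ε => ?_
        beta_reduce
        by_cases hzf : z ∈ farFromMid β ε
        · rw [Set.indicator_of_mem hzf, this, zero_mul]
        · rw [Set.indicator_of_notMem hzf, this, zero_mul]
      · have : 0 < |z - cellMid T z| := abs_pos.2 (sub_ne_zero.2 (Ne.symm hz))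
        filter_upwards [nhdsWithin_le_nhds (Iio_mem_nhds this)] with ε hε
        have hzf : z ∈ farFromMid β ε := (Set.mem_Iio.1 hε).le
        rw [Set.indicator_of_mem hzf]
  · have hN : ∀ N : ℕ, (∫ z in Set.Ioi (0 : ℝ), h z * (Real.sin (β / 2 * z) : ℂ)) -
        (-1) ^ N * ∫ z in Set.Ioi (0 : ℝ), h z * (Real.sin ((N + 1 / 2) * β * z) : ℂ) =
        ∫ z in Set.Ioi (0 : ℝ), g z * (altSinSum N (β * z) : ℂ) := by
      intro N
      have hI := hbdd hpi' ((continuous_altSinSum N).measurable.comp (measurable_const_mul β))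
        (fun z => abs_altSinSum_le N (β * z))
      have h0 := setIntegral_cellMid_mul_eq_zero hT hI fun k z _ => altSinSum_reflect hβ N k z
      have hs1 := hbdd hhi (hsm (β / 2)) (hsm1 _)
      have hs2 := (hbdd hhi (hsm ((N + 1 / 2) * β)) (hsm1 _)).const_mul ((-1 : ℂ) ^ N)
      have hs12 : IntegrableOn (fun z => h z * (Real.sin (β / 2 * z) : ℂ) -
          (-1) ^ N * (h z * (Real.sin ((N + 1 / 2) * β * z) : ℂ))) (Set.Ioi 0) := hs1.sub hs2
      rw [← integral_const_mul, ← integral_sub hs1 hs2,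
        ← add_zero (∫ z in Set.Ioi (0 : ℝ), _), ← h0, ← integral_add hs12 hI]
      congr 1
      funext z
      conv_rhs => rw [hsplit z]
      have hD := cos_half_mul_sum_sin (β * z) N
      have hD' : (Real.cos (β * z / 2) : ℂ) * (altSinSum N (β * z) : ℂ) =
          (Real.sin (β / 2 * z) : ℂ) - (-1) ^ N * (Real.sin ((N + 1 / 2) * β * z) : ℂ) := by
        rw [altSinSum, ← Complex.ofReal_mul, hD, mul_assoc _ β z, mul_div_right_comm]
        push_cast
        rfl
      simp only [Function.comp_apply]
      linear_combination -(h z) * hD'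
    have hR : Tendsto (fun N : ℕ =>
        ∫ z in Set.Ioi (0 : ℝ), h z * (Real.sin ((N + 1 / 2) * β * z) : ℂ)) atTop (𝓝 0) :=
      (tendsto_setIntegral_mul_sin hhi).comp
        ((tendsto_atTop_add_const_right _ _ tendsto_natCast_atTop_atTop).atTop_mul_const hβ)
    -- The sign (-1)^N has no limit but modulus one, so the remainder is handled through its norm.
    have hR' := (hR.norm).congr (f₂ := fun N : ℕ => ‖(-1 : ℂ) ^ N *
        ∫ z in Set.Ioi (0 : ℝ), h z * (Real.sin ((N + 1 / 2) * β * z) : ℂ)‖) (fun N => by simp)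
    rw [norm_zero] at hR'
    have := (tendsto_zero_iff_norm_tendsto_zero.2 hR').const_sub
      (∫ z in Set.Ioi (0 : ℝ), h z * (Real.sin (β / 2 * z) : ℂ))
    rw [sub_zero] at this
    exact this.congr hN

/-! ### The principal value for the Fermi integrand -/

theorem measurable_fermi (n : ℂ) (c : ℝ) : Measurable (fermi n c) := by
  unfold fermi
  fun_prop

/-- The derivative is kept in terms of `fermi` at n - 1 and n so that the same exponential bound
serves both; at n - 1 it needs Re n > 2. -/
theorem hasDerivAt_fermi (n : ℂ) (c : ℝ) {z : ℝ} (hz : 0 < z) :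
    HasDerivAt (fermi n c) ((n - 1) * fermi (n - 1) c z -
      c * fermi n c z * ((Real.exp (c * z) / (Real.exp (c * z) + 1) : ℝ) : ℂ)) z := by
  have h1 : HasDerivAt (fun x : ℝ => (x : ℂ) ^ (n - 1)) ((n - 1) * (z : ℂ) ^ (n - 1 - 1)) z :=
    (Complex.hasStrictDerivAt_cpow_const
      (Complex.ofReal_mem_slitPlane.2 hz)).hasDerivAt.comp_ofReal
  have h2 : HasDerivAt (fun x : ℝ => ((Real.exp (c * x) + 1 : ℝ) : ℂ))
      ((Real.exp (c * z) * c : ℝ) : ℂ) z := by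
    have h := (((hasDerivAt_id z).const_mul c).exp.add_const 1).ofReal_comp
    rw [mul_one] at h
    exact h
  have h0 : ((Real.exp (c * z) + 1 : ℝ) : ℂ) ≠ 0 := by
    exact_mod_cast (by positivity : Real.exp (c * z) + 1 ≠ 0)
  refine (h1.div h2 h0).congr_deriv ?_
  rw [fermi, fermi, Complex.ofReal_div, Complex.ofReal_mul]
  field_simp

theorem norm_deriv_fermi_le {n : ℂ} (hn : 2 < n.re) {c : ℝ} (hc : 0 < c) {z : ℝ} (hz : 0 < z) :
    ‖(n - 1) * fermi (n - 1) c z -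
      c * fermi n c z * ((Real.exp (c * z) / (Real.exp (c * z) + 1) : ℝ) : ℂ)‖ ≤
    (‖n - 1‖ * ((n.re - 1 - 1) / (c / 2)) ^ (n.re - 1 - 1) +
      c * ((n.re - 1) / (c / 2)) ^ (n.re - 1)) * Real.exp (-(c / 2 * z)) := by
  have h1 := norm_fermi_le_exp (n := n - 1) (by simp; linarith) hc hz
  have h2 := norm_fermi_le_exp (n := n) (by linarith) hc hz
  simp only [Complex.sub_re, Complex.one_re] at h1
  refine (norm_sub_le _ _).trans ?_
  rw [norm_mul, norm_mul, norm_mul, Complex.norm_of_nonneg hc.le,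
    Complex.norm_of_nonneg (by positivity), add_mul, mul_assoc ‖n - 1‖, mul_assoc c]
  refine add_le_add (mul_le_mul_of_nonneg_left h1 (norm_nonneg _)) ?_
  rw [mul_assoc]
  refine mul_le_mul_of_nonneg_left ?_ hc.le
  refine (mul_le_of_le_one_right (norm_nonneg _) ?_).trans h2
  exact div_le_one_of_le₀ (by linarith) (by positivity)

theorem integrableOn_fermi {n : ℂ} (hn : 1 < n.re) {c : ℝ} (hc : 0 < c) :
    IntegrableOn (fermi n c) (Set.Ioi 0) :=
  integrableOn_of_norm_le_exp (measurable_fermi n c) (half_pos hc)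
    fun _ hz => norm_fermi_le_exp hn hc hz

theorem two_mul_integral_fermi_mul_sin {n : ℂ} (hn : 1 < n.re) {c : ℝ} (hc : 0 < c) (w : ℝ) :
    2 * ∫ z in Set.Ioi (0 : ℝ), fermi n c z * (Real.sin (w * z) : ℂ) =
      -Complex.I * ((∫ z in Set.Ioi (0 : ℝ), fermi n c z *
          Complex.exp (-(Complex.I * ((-w : ℝ) : ℂ) * z))) -
        ∫ z in Set.Ioi (0 : ℝ), fermi n c z * Complex.exp (-(Complex.I * w * z))) := by
  have hint : ∀ u : ℝ, IntegrableOn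
      (fun v : ℝ => fermi n c v * Complex.exp (-(Complex.I * u * v))) (Set.Ioi 0) := by
    intro u
    refine Integrable.mul_bdd (c := 1) (integrableOn_fermi hn hc) (by fun_prop)
      (Eventually.of_forall fun v => ?_)
    rw [Complex.norm_exp]
    simp
  rw [← integral_sub (hint _) (hint _), ← integral_const_mul, ← integral_const_mul]
  congr 1
  funext z
  rw [Complex.ofReal_sin, Complex.sin]
  push_cast
  have e1 : -(Complex.I * -(w : ℂ) * z) = (w * z : ℂ) * Complex.I := by ring
  have e2 : -(Complex.I * (w : ℂ) * z) = -(w * z : ℂ) * Complex.I := by ring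
  rw [e1, e2]
  ring

/-- Each sine is a difference of two exponentials, so these integrals are the partial sums of the
series for -β and β. -/
theorem tendsto_integral_fermi_mul_altSinSum {n : ℂ} (hn : 2 < n.re) {c β : ℝ} (hc : 0 < c)
    (hβ : 0 < β) :
    Tendsto (fun N : ℕ => ∫ z in Set.Ioi (0 : ℝ), fermi n c z * (altSinSum N (β * z) : ℂ)) atTop
      (𝓝 (-Complex.I * (Complex.Gamma n * fermiDoubleSum n c (-β) -
        Complex.Gamma n * fermiDoubleSum n c β))) := by
  have h := ((hasSum_neg_one_pow_mul_integral_fermi hn hc (neg_ne_zero.2 hβ.ne')).sub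
    (hasSum_neg_one_pow_mul_integral_fermi hn hc hβ.ne')).mul_left (-Complex.I)
  refine h.tendsto_sum_nat.congr fun N => ?_
  have hint : ∀ l ∈ Finset.range N, IntegrableOn (fun z => 2 * (-1) ^ l *
      (fermi n c z * (Real.sin (β * ((l : ℝ) + 1) * z) : ℂ))) (Set.Ioi 0) := by
    intro l _
    refine Integrable.const_mul (Integrable.mul_bdd (c := 1)
      (integrableOn_fermi (by linarith) hc) (by fun_prop) (Eventually.of_forall fun v => ?_)) _
    rw [Complex.norm_real]
    exact Real.abs_sin_le_one _
  have e : ∀ z : ℝ, fermi n c z * (altSinSum N (β * z) : ℂ) = ∑ l ∈ Finset.range N,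
      2 * (-1) ^ l * (fermi n c z * (Real.sin (β * ((l : ℝ) + 1) * z) : ℂ)) := by
    intro z
    rw [altSinSum, Complex.ofReal_sum, Finset.mul_sum]
    refine Finset.sum_congr rfl fun l _ => ?_
    rw [show ((l : ℝ) + 1) * (β * z) = β * ((l : ℝ) + 1) * z by ring]
    push_cast
    ring
  simp_rw [e]
  rw [integral_finsetSum _ hint]
  refine Finset.sum_congr rfl fun l _ => ?_
  rw [integral_const_mul, mul_comm (2 : ℂ), mul_assoc ((-1 : ℂ) ^ l),
    two_mul_integral_fermi_mul_sin (by linarith) hc, neg_mul β]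
  ring

theorem hasCauchyPV_tanIntegrand {n : ℂ} (hn : 2 < n.re) {β : ℝ} (hβ : 0 < β) :
    HasCauchyPV (tanIntegrand n β) (Set.Ioi 0) (tanPoles β)
      (-Complex.I * (Complex.Gamma n * fermiDoubleSum n (2 * Real.pi) (-β) -
        Complex.Gamma n * fermiDoubleSum n (2 * Real.pi) β)) := by
  have hc : 0 < 2 * Real.pi := by have := Real.pi_pos; positivity
  have hC1 : 0 ≤ ((n.re - 1) / (2 * Real.pi / 2)) ^ (n.re - 1) :=
    Real.rpow_nonneg (div_nonneg (by linarith) (by linarith)) _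
  have hC2 : 0 ≤ ‖n - 1‖ * ((n.re - 1 - 1) / (2 * Real.pi / 2)) ^ (n.re - 1 - 1) +
      2 * Real.pi * ((n.re - 1) / (2 * Real.pi / 2)) ^ (n.re - 1) := by
    have : 0 ≤ ((n.re - 1 - 1) / (2 * Real.pi / 2)) ^ (n.re - 1 - 1) :=
      Real.rpow_nonneg (div_nonneg (by linarith) (by linarith)) _
    positivity
  -- One constant must bound both the function and its derivative, hence the sum of the two.
  obtain ⟨I, hI, hlim⟩ := exists_hasCauchyPV_tan hβ (add_nonneg hC1 hC2) (half_pos hc)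
    (measurable_fermi n (2 * Real.pi)) (fun z hz => hasDerivAt_fermi n (2 * Real.pi) hz)
    (fun z hz => (norm_fermi_le_exp (by linarith) hc hz).trans
      (mul_le_mul_of_nonneg_right (le_add_of_nonneg_right hC2) (Real.exp_pos _).le))
    (fun z hz => (norm_deriv_fermi_le hn hc hz).trans
      (mul_le_mul_of_nonneg_right (le_add_of_nonneg_left hC1) (Real.exp_pos _).le))
  rw [← tendsto_nhds_unique hlim (tendsto_integral_fermi_mul_altSinSum hn hc hβ)]
  exact hI

/-! ### Assembly -/

theorem mainTheorem8 (n : ℂ) (hn : 2 < n.re) (α β : ℝ) (hα : 0 < α) (hβ : 0 < β)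
    (hαβ : α * β = 4 * Real.pi ^ 2) :
    Summable (halfIntTerm n α) ∧ Summable (halfIntTerm n β) ∧
    ∃ I : ℂ, HasCauchyPV (tanIntegrand n β) (Set.Ioi 0) (tanPoles β) I ∧
      (∑' j : ℕ, halfIntTerm n β j) +
          Complex.Gamma n * ((2 : ℂ) ^ (1 - n) - 1) * riemannZeta n / (β : ℂ) ^ n =
        Complex.cos (Real.pi * n / 2) *
            (((α / β : ℝ) : ℂ) ^ (n / 2) * (∑' j : ℕ, halfIntTerm n α j) +
              Complex.Gamma n * ((2 : ℂ) ^ (1 - n) - 1) * riemannZeta n /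
                (2 * Real.pi : ℂ) ^ n) -
          Complex.sin (Real.pi * n / 2) * I := by
  have hpi := Real.pi_pos
  have hc : 0 < 2 * Real.pi := by positivity
  refine ⟨summable_halfIntTerm (by linarith) hα, summable_halfIntTerm (by linarith) hβ, _,
    hasCauchyPV_tanIntegrand hn hβ, ?_⟩
  rw [tsum_halfIntTerm hn hα, tsum_halfIntTerm hn hβ]
  -- By αβ = 4π², the pair (α, 2π) is t times (2π, β), and (α/β)^(n/2) = t^n cancels the scaling
  -- factor.
  set t : ℝ := 2 * Real.pi / β with ht
  have htpos : 0 < t := by positivity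
  have ha : α = t * (2 * Real.pi) := by
    rw [ht]; field_simp; linarith
  have hb : 2 * Real.pi = t * β := by rw [ht]; field_simp
  have hratio : α / β = t ^ 2 := by
    rw [ha, ht]; field_simp
  have hpow : ((α / β : ℝ) : ℂ) ^ (n / 2) = (t : ℂ) ^ n := by
    rw [hratio, sq, Complex.ofReal_mul, Complex.mul_cpow_ofReal_nonneg htpos.le htpos.le,
      ← Complex.cpow_add _ _ (by exact_mod_cast htpos.ne'), add_halves]
  have htn : (t : ℂ) ^ n ≠ 0 := by
    rw [Complex.cpow_ne_zero_iff]
    exact Or.inl (by exact_mod_cast htpos.ne')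
  have hαn : (α : ℂ) ^ n = (t : ℂ) ^ n * (2 * Real.pi : ℂ) ^ n := by
    rw [ha, Complex.ofReal_mul, Complex.mul_cpow_ofReal_nonneg htpos.le hc.le]
    push_cast
    rfl
  have hinv : (1 / (t : ℂ)) ^ n = ((t : ℂ) ^ n)⁻¹ := by
    rw [one_div, Complex.inv_cpow_ofReal_nonneg htpos.le]
  have hE1 : fermiDoubleSum n α (2 * Real.pi) =
      ((t : ℂ) ^ n)⁻¹ * fermiDoubleSum n (2 * Real.pi) β := by
    rw [← hinv, ← fermiDoubleSum_mul htpos hc, ← ha, ← hb]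
  have hE2 : fermiDoubleSum n α (-(2 * Real.pi)) =
      ((t : ℂ) ^ n)⁻¹ * fermiDoubleSum n (2 * Real.pi) (-β) := by
    rw [← hinv, ← fermiDoubleSum_mul htpos hc, ← ha, mul_neg, ← hb]
  have hS1 := fermiDoubleSum_swap_neg n (a := 2 * Real.pi) hβ
  have hS2 := fermiDoubleSum_swap_neg n (a := β) hc
  rw [hpow, hαn, hE1, hE2, hS2, hS1]
  set φ : ℂ := Real.pi * n / 2 with hφ
  set X := fermiDoubleSum n β (2 * Real.pi)
  set Y := fermiDoubleSum n (2 * Real.pi) β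
  have hexp : Complex.exp (Complex.I * φ) = Complex.cos φ + Complex.sin φ * Complex.I := by
    rw [mul_comm, Complex.exp_mul_I]
  rw [hexp]
  have hcs := Complex.sin_sq_add_cos_sq φ
  have h1 : ∀ A P : ℂ, (t : ℂ) ^ n * (A / ((t : ℂ) ^ n * P)) = A / P := fun A P => by
    rw [← mul_div_assoc, mul_div_mul_left _ _ htn]
  rw [mul_sub ((t : ℂ) ^ n), h1]
  have h2 := mul_inv_cancel_left₀ htn (Y + (Complex.cos φ + Complex.sin φ * Complex.I) * X)
  -- With e = e^(iφ): cos φ (Y + eX) - i sin φ (eX - Y) = X + eY, and the zeta terms cancel on each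
  -- side.
  linear_combination (Complex.cos φ * Complex.Gamma n) * h2 + Complex.Gamma n * X * hcs -
    Complex.Gamma n * X * Complex.sin φ ^ 2 * Complex.I_sq
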